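/- Let $\mathcal L$ be a real Hilbert space, let $(\Omega,\Sigma,\mathbb P)$ be a probability space, and let $\Phi:\mathcal L\to L^2(\Omega,\mathbb P)$ (real-valued functions) be a Gaussian field: $\mathbb E[\Phi(h)]=0$ for every $h\in\mathcal L$, and for all $n\in\mathbb N$ and $h_1,\dots,h_n\in\mathcal L$ the random vector $(\Phi(h_1),\dots,\Phi(h_n))$ has the centred (possibly degenerate) Gaussian law on $\mathbb R^n$ with covariance matrix $(\langle h_i,h_j\rangle_{\mathcal L})_{i,j}$. Let $\mathcal H_1=L^2(\Omega,\mathbb P)$ and let $\mathcal H_2=L^2(\Omega,\mathbb P)\otimes\mathcal L$ be the Hilbert tensor product, identified with the space $L^2(\Omega,\mathbb P;\mathcal L)$ of square-integrable $\mathcal L$-valued random variables, so that $F\otimes k$ is $\omega\mapsto F(\omega)k$. The Malliavin derivative $T$ is the linear operator from $\mathcal H_1$ to $\mathcal H_2$ whose domain is the linear span of all random variables $p(\Phi(h_1),\dots,\Phi(h_n))$ with $n\in\mathbb N$, $p\in\mathbb R[x_1,\dots,x_n]$ and $h_1,\dots,h_n\in\mathcal L$, given by $$T\bigl(p(\Phi(h_1),\dots,\Phi(h_n))\bigr)=\sum_{j=1}^n\frac{\partial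 p}{\partial x_j}(\Phi(h_1),\dots,\Phi(h_n))\otimes h_j .$$ Then $T$ is closable, and the kernel $\{F\in\operatorname{dom}\overline T:\overline T F=0\}$ of its closure $\overline T$ is the one-dimensional subspace of $\mathcal H_1$ spanned by the constant function $\mathbf 1$. -/

import Mathlib

open MeasureTheory ProbabilityTheory
open scoped ENNReal

namespace GaussianField

variable {Ω : Type*} {mΩ : MeasurableSpace Ω} {L : Type*} [NormedAddCommGroup L]
  [InnerProductSpace ℝ L]

/-- A Gaussian field (Gaussian Hilbert space) `(Ω, Σ, P, Φ)` indexed by the real Hilbert space `L`: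
every `Φ h` is centred, and any finite tuple `(Φ h₁, …, Φ hₙ)` is jointly Gaussian, its law being
the centred Gaussian measure on `ℝⁿ` whose covariance is the Gram matrix of `h₁, …, hₙ`
(which has a density when `h₁, …, hₙ` are linearly independent, and is degenerate otherwise). -/
structure IsGaussianField (P : Measure Ω) (Φ : L → Lp ℝ 2 P) : Prop where
  integral_eq_zero : ∀ h : L, ∫ ω, Φ h ω ∂P = 0
  map_eq : ∀ (n : ℕ) (h : Fin n → L),
    P.map (fun ω ↦ (WithLp.toLp 2 (fun i ↦ Φ (h i) ω) : EuclideanSpace ℝ (Fin n))) =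
      multivariateGaussian 0 (Matrix.gram ℝ h)

variable {P : Measure Ω} {Φ : L → Lp ℝ 2 P}

namespace IsGaussianField

theorem aemeasurable_tuple {P : Measure Ω} {ι : Type*} (Φ : ι → Lp ℝ 2 P) {n : ℕ}
    (h : Fin n → ι) :
    AEMeasurable (fun ω ↦ (WithLp.toLp 2 (fun i ↦ Φ (h i) ω) : EuclideanSpace ℝ (Fin n))) P := by
  have h1 : AEMeasurable (fun ω i ↦ Φ (h i) ω) P :=
    aemeasurable_pi_lambda _ fun i ↦ (Lp.aestronglyMeasurable (Φ (h i))).aemeasurable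
  exact (WithLp.measurable_toLp 2 (Fin n → ℝ)).comp_aemeasurable h1

theorem hasGaussianLaw (hΦ : IsGaussianField P Φ) (h : L) : HasGaussianLaw (Φ h) P := by
  have h1 : HasGaussianLaw
      (fun ω ↦ (WithLp.toLp 2 (fun _ ↦ Φ h ω) : EuclideanSpace ℝ (Fin 1))) P :=
    ⟨by rw [hΦ.map_eq 1 (fun _ ↦ h)]; infer_instance⟩
  exact h1.map (EuclideanSpace.proj (0 : Fin 1))

/-- Polynomials in the Gaussian variables have moments of all orders. -/
theorem memLp_eval [IsFiniteMeasure P] (hΦ : IsGaussianField P Φ) {n : ℕ} (h : Fin n → L)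
    (p : MvPolynomial (Fin n) ℝ) (r : ℝ≥0∞) (hr : r ≠ ∞) :
    MemLp (fun ω ↦ MvPolynomial.eval (fun i ↦ Φ (h i) ω) p) r P := by
  induction p using MvPolynomial.induction_on generalizing r with
  | C a => simpa using memLp_const a
  | add p q hp hq =>
    simp only [map_add]
    exact (hp r hr).add (hq r hr)
  | mul_X p i hp =>
    have h2 : 2 * r ≠ ∞ := ENNReal.mul_ne_top (by norm_num) hr
    have : ENNReal.HolderTriple (2 * r) (2 * r) r := ⟨by
      rw [ENNReal.mul_inv (by simp) (by simp), ← add_mul, ENNReal.inv_two_add_inv_two, one_mul]⟩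
    simpa using ((hΦ.hasGaussianLaw (h i)).memLp h2).mul' (hp (2 * r) h2)

end IsGaussianField

/-- The random variable `p(Φ h₁, …, Φ hₙ)`, as an element of `L²(Ω, P)`, linear in `p`. -/
noncomputable def polyVal [IsFiniteMeasure P] (hΦ : IsGaussianField P Φ) {n : ℕ} (h : Fin n → L) :
    MvPolynomial (Fin n) ℝ →ₗ[ℝ] Lp ℝ 2 P where
  toFun p := (hΦ.memLp_eval h p 2 (by norm_num)).toLp
    (fun ω ↦ MvPolynomial.eval (fun i ↦ Φ (h i) ω) p)
  map_add' p q := by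
    rw [← MemLp.toLp_add]; congr 1; ext ω; simp
  map_smul' c p := by
    rw [RingHom.id_apply, ← MemLp.toLp_const_smul]; congr 1; ext ω; simp [MvPolynomial.smul_eval]

/-- The elementary tensor `F ⊗ k`, in `L²(Ω, P) ⊗ L` realized as `L²(Ω, P; L)`:
it is the `L`-valued random variable `ω ↦ F(ω) k`. -/
noncomputable def elemTensor (F : Lp ℝ 2 P) (k : L) : Lp L 2 P :=
  (ContinuousLinearMap.toSpanSingleton ℝ k).compLp F

/-- `∑ⱼ (∂p/∂xⱼ)(Φ h₁, …, Φ hₙ) ⊗ hⱼ`. -/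
noncomputable def polyGrad [IsFiniteMeasure P] (hΦ : IsGaussianField P Φ) {n : ℕ} (h : Fin n → L)
    (p : MvPolynomial (Fin n) ℝ) : Lp L 2 P :=
  ∑ j, elemTensor (polyVal hΦ h (MvPolynomial.pderiv j p)) (h j)

/-- The graph of the Malliavin derivative: the span of all the pairs
`(p(Φ h₁, …, Φ hₙ), ∑ⱼ (∂p/∂xⱼ)(Φ h₁, …, Φ hₙ) ⊗ hⱼ)`. -/
noncomputable def malliavinGraph [IsFiniteMeasure P] (hΦ : IsGaussianField P Φ) :
    Submodule ℝ (Lp ℝ 2 P × Lp L 2 P) :=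
  Submodule.span ℝ {x | ∃ (n : ℕ) (h : Fin n → L) (p : MvPolynomial (Fin n) ℝ),
    x = (polyVal hΦ h p, polyGrad hΦ h p)}

/-- The Malliavin derivative `T`, an unbounded operator from `L²(Ω, P)` to `L²(Ω, P) ⊗ L`. Its
domain is the span of the random variables `p(Φ h₁, …, Φ hₙ)`, on which
`T (p(Φ h₁, …, Φ hₙ)) = ∑ⱼ (∂p/∂xⱼ)(Φ h₁, …, Φ hₙ) ⊗ hⱼ`; see `malliavinDerivative_domain` and
`malliavinDerivative_apply` below (in particular `T` is well defined). -/
noncomputable def malliavinDerivative [IsFiniteMeasure P] (hΦ : IsGaussianField P Φ) :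
    Lp ℝ 2 P →ₗ.[ℝ] Lp L 2 P :=
  (malliavinGraph hΦ).toLinearPMap

/-- The kernel of an unbounded operator, as a subspace of the space containing its domain. -/
def pmapKer {E F : Type*} [AddCommGroup E] [Module ℝ E] [AddCommGroup F] [Module ℝ F]
    (T : E →ₗ.[ℝ] F) : Submodule ℝ E :=
  (LinearMap.ker T.toFun).map T.domain.subtype

/-! ### The Malliavin derivative is well defined -/

theorem coeFn_elemTensor (F : Lp ℝ 2 P) (k : L) : elemTensor F k =ᵐ[P] fun ω ↦ F ω • k :=
  ContinuousLinearMap.coeFn_compLp _ F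

theorem coeFn_polyVal [IsFiniteMeasure P] (hΦ : IsGaussianField P Φ) {n : ℕ} (h : Fin n → L)
    (p : MvPolynomial (Fin n) ℝ) :
    polyVal hΦ h p =ᵐ[P] fun ω ↦ MvPolynomial.eval (fun i ↦ Φ (h i) ω) p :=
  MemLp.coeFn_toLp (hΦ.memLp_eval h p 2 (by norm_num))

theorem elemTensor_add_left (F G : Lp ℝ 2 P) (k : L) :
    elemTensor (F + G) k = elemTensor F k + elemTensor G k := by
  refine Lp.ext ?_
  filter_upwards [coeFn_elemTensor (F + G) k, coeFn_elemTensor F k, coeFn_elemTensor G k,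
    Lp.coeFn_add F G, Lp.coeFn_add (elemTensor F k) (elemTensor G k)] with ω h1 h2 h3 h4 h5
  rw [h1, h5, Pi.add_apply, h2, h3, h4, Pi.add_apply, add_smul]

theorem elemTensor_smul_left (c : ℝ) (F : Lp ℝ 2 P) (k : L) :
    elemTensor (c • F) k = c • elemTensor F k := by
  refine Lp.ext ?_
  filter_upwards [coeFn_elemTensor (c • F) k, coeFn_elemTensor F k,
    Lp.coeFn_smul c F, Lp.coeFn_smul c (elemTensor F k)] with ω h1 h2 h4 h5
  rw [h1, h5, Pi.smul_apply, h2, h4, Pi.smul_apply, smul_eq_mul, mul_smul]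

theorem elemTensor_add_right (F : Lp ℝ 2 P) (k l : L) :
    elemTensor F (k + l) = elemTensor F k + elemTensor F l := by
  refine Lp.ext ?_
  filter_upwards [coeFn_elemTensor F (k + l), coeFn_elemTensor F k, coeFn_elemTensor F l,
    Lp.coeFn_add (elemTensor F k) (elemTensor F l)] with ω h1 h2 h3 h5
  rw [h1, h5, Pi.add_apply, h2, h3, smul_add]

theorem elemTensor_smul_right (c : ℝ) (F : Lp ℝ 2 P) (k : L) :
    elemTensor F (c • k) = c • elemTensor F k := by
  refine Lp.ext ?_
  filter_upwards [coeFn_elemTensor F (c • k), coeFn_elemTensor F k,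
    Lp.coeFn_smul c (elemTensor F k)] with ω h1 h2 h5
  rw [h1, h5, Pi.smul_apply, h2, smul_comm]

/-- The elementary tensor as a bilinear map. -/
noncomputable def elemTensorₗ : Lp ℝ 2 P →ₗ[ℝ] L →ₗ[ℝ] Lp L 2 P :=
  LinearMap.mk₂ ℝ elemTensor elemTensor_add_left elemTensor_smul_left
    elemTensor_add_right elemTensor_smul_right

theorem polyGrad_eq [IsFiniteMeasure P] (hΦ : IsGaussianField P Φ) {n : ℕ} (h : Fin n → L)
    (p : MvPolynomial (Fin n) ℝ) :
    polyGrad hΦ h p = ∑ j, elemTensorₗ (polyVal hΦ h (MvPolynomial.pderiv j p)) (h j) := rfl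

theorem polyGrad_add [IsFiniteMeasure P] (hΦ : IsGaussianField P Φ) {n : ℕ} (h : Fin n → L)
    (p q : MvPolynomial (Fin n) ℝ) :
    polyGrad hΦ h (p + q) = polyGrad hΦ h p + polyGrad hΦ h q := by
  simp [polyGrad_eq, Finset.sum_add_distrib]

theorem polyGrad_smul [IsFiniteMeasure P] (hΦ : IsGaussianField P Φ) {n : ℕ} (h : Fin n → L)
    (c : ℝ) (p : MvPolynomial (Fin n) ℝ) :
    polyGrad hΦ h (c • p) = c • polyGrad hΦ h p := by
  simp [polyGrad_eq, Finset.smul_sum]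

theorem IsGaussianField.integral_mul (hΦ : IsGaussianField P Φ) (h k : L) :
    ∫ ω, Φ h ω * Φ k ω ∂P = inner ℝ h k := by
  have hm := aemeasurable_tuple Φ ![h, k]
  have h1 := covariance_eval_multivariateGaussian (μ := 0)
    (Matrix.posSemidef_gram ℝ ![h, k]) 0 1
  rw [← hΦ.map_eq 2 ![h, k], covariance_map (by fun_prop) (by fun_prop) hm] at h1
  have hP := (hΦ.hasGaussianLaw h).isProbabilityMeasure
  have h2 : cov[Φ h, Φ k; P] = inner ℝ h k := by
    simpa [Function.comp_def, Matrix.gram_apply] using h1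
  rw [covariance_eq_sub (Lp.memLp _) (Lp.memLp _)] at h2
  simpa [hΦ.integral_eq_zero] using h2

theorem IsGaussianField.inner_eq (hΦ : IsGaussianField P Φ) (h k : L) :
    inner ℝ (Φ h) (Φ k) = inner ℝ h k := by
  rw [← hΦ.integral_mul h k, L2.inner_def]
  simp [mul_comm]

theorem IsGaussianField.map_sum (hΦ : IsGaussianField P Φ) {m : ℕ} (c : Fin m → ℝ)
    (e : Fin m → L) : Φ (∑ j, c j • e j) = ∑ j, c j • Φ (e j) := by
  rw [← sub_eq_zero, ← inner_self_eq_zero (𝕜 := ℝ)]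
  have : inner ℝ (∑ j, c j • e j - ∑ j, c j • e j) (∑ j, c j • e j - ∑ j, c j • e j) = (0 : ℝ) := by
    simp
  rw [← this]
  simp only [inner_sub_left, inner_sub_right, sum_inner, inner_sum, real_inner_smul_left,
    real_inner_smul_right, hΦ.inner_eq, Finset.mul_sum]
  have hsymm : ∑ x, ∑ y, c x * (c y * inner ℝ (e x) (e y)) =
      ∑ x, ∑ y, c x * (c y * inner ℝ (e y) (e x)) := by
    simp only [real_inner_comm]
  simp only [hsymm, sub_self, Finset.sum_const_zero]

/-- Linear change of variables in a polynomial. -/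
noncomputable def linSubst {n m : ℕ} (A : Fin n → Fin m → ℝ) :
    MvPolynomial (Fin n) ℝ →ₐ[ℝ] MvPolynomial (Fin m) ℝ :=
  MvPolynomial.aeval fun i ↦ ∑ j, MvPolynomial.C (A i j) * MvPolynomial.X j

theorem eval_linSubst {n m : ℕ} (A : Fin n → Fin m → ℝ) (p : MvPolynomial (Fin n) ℝ)
    (x : Fin m → ℝ) :
    MvPolynomial.eval x (linSubst A p) = MvPolynomial.eval (fun i ↦ ∑ j, A i j * x j) p := by
  induction p using MvPolynomial.induction_on with
  | C a => simp [linSubst]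
  | add p q hp hq => simp [hp, hq]
  | mul_X p i hp => simp [hp]; simp [linSubst]

theorem pderiv_linSubst {n m : ℕ} (A : Fin n → Fin m → ℝ) (p : MvPolynomial (Fin n) ℝ)
    (j : Fin m) :
    MvPolynomial.pderiv j (linSubst A p) =
      ∑ i, A i j • linSubst A (MvPolynomial.pderiv i p) := by
  classical
  induction p using MvPolynomial.induction_on with
  | C a => simp [linSubst]
  | add p q hp hq => simp [hp, hq, Finset.sum_add_distrib]
  | mul_X p k hp =>
    have hX : MvPolynomial.pderiv j (linSubst A (MvPolynomial.X k)) = MvPolynomial.C (A k j) := by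
      simp [linSubst, MvPolynomial.pderiv_X, Pi.single_apply]
    rw [map_mul, Derivation.leibniz, hp, hX]
    simp only [Derivation.leibniz, MvPolynomial.pderiv_X, smul_eq_mul, map_add, map_mul, smul_add,
      Finset.sum_add_distrib, Finset.mul_sum]
    congr 1
    · rw [Finset.sum_eq_single k]
      · simp [MvPolynomial.smul_eq_C_mul, mul_comm]
      · intro i _ hi
        simp [hi]
      · simp
    · simp

theorem polyVal_linSubst [IsFiniteMeasure P] (hΦ : IsGaussianField P Φ) {n m : ℕ}
    (A : Fin n → Fin m → ℝ) (h : Fin n → L) (e : Fin m → L) (hA : ∀ i, h i = ∑ j, A i j • e j)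
    (p : MvPolynomial (Fin n) ℝ) : polyVal hΦ e (linSubst A p) = polyVal hΦ h p := by
  refine Lp.ext ?_
  have h1 : ∀ i, Φ (h i) =ᵐ[P] fun ω ↦ ∑ j, A i j * Φ (e j) ω := fun i ↦ by
    rw [hA, hΦ.map_sum]
    have h2 : ∀ᵐ ω ∂P, ∀ j, (A i j • Φ (e j) : Lp ℝ 2 P) ω = A i j * Φ (e j) ω :=
      ae_all_iff.2 fun j ↦ by
        filter_upwards [Lp.coeFn_smul (A i j) (Φ (e j))] with ω hω using by simp [hω]
    filter_upwards [Lp.coeFn_finsetSum Finset.univ (fun j ↦ A i j • Φ (e j)), h2] with ω h3 h4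
    rw [h3]
    simp [h4]
  filter_upwards [coeFn_polyVal hΦ e (linSubst A p), coeFn_polyVal hΦ h p,
    ae_all_iff.2 h1] with ω h2 h3 h4
  rw [h2, h3, eval_linSubst]
  simp [h4]

theorem polyGrad_linSubst [IsFiniteMeasure P] (hΦ : IsGaussianField P Φ) {n m : ℕ}
    (A : Fin n → Fin m → ℝ) (h : Fin n → L) (e : Fin m → L) (hA : ∀ i, h i = ∑ j, A i j • e j)
    (p : MvPolynomial (Fin n) ℝ) : polyGrad hΦ e (linSubst A p) = polyGrad hΦ h p := by
  simp only [polyGrad_eq, pderiv_linSubst, map_sum, map_smul, polyVal_linSubst hΦ A h e hA,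
    LinearMap.sum_apply, LinearMap.smul_apply]
  rw [Finset.sum_comm]
  refine Finset.sum_congr rfl fun i _ ↦ ?_
  conv_rhs => rw [hA i]
  simp

/-- Every finite-dimensional subspace has an orthonormal basis indexed by some `Fin m`, in which
all its vectors can be expanded. -/
theorem exists_orthonormal (S : Submodule ℝ L) [FiniteDimensional ℝ S] :
    ∃ (m : ℕ) (e : Fin m → L), Orthonormal ℝ e ∧
      ∀ x ∈ S, ∃ a : Fin m → ℝ, x = ∑ j, a j • e j := by
  let b := stdOrthonormalBasis ℝ S
  refine ⟨_, fun j ↦ (b j : L), b.orthonormal.comp_linearIsometry S.subtypeₗᵢ, fun x hx ↦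
    ⟨fun j ↦ b.repr ⟨x, hx⟩ j, ?_⟩⟩
  have := congrArg (Subtype.val) (b.sum_repr ⟨x, hx⟩)
  simpa using this.symm

theorem eq_zero_of_polyVal_eq_zero [IsFiniteMeasure P] (hΦ : IsGaussianField P Φ) {m : ℕ}
    (e : Fin m → L) (he : Orthonormal ℝ e) (q : MvPolynomial (Fin m) ℝ)
    (hq : polyVal hΦ e q = 0) : q = 0 := by
  have hG : Matrix.gram ℝ e = 1 := by
    ext i j
    rw [Matrix.gram_apply, orthonormal_iff_ite.1 he, Matrix.one_apply]
  have hlaw := hΦ.map_eq m e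
  rw [hG, multivariateGaussian_zero_one, ← map_pi_eq_stdGaussian] at hlaw
  have hcont : Continuous fun x : Fin m → ℝ ↦ MvPolynomial.eval x q := MvPolynomial.continuous_eval q
  have h0 : ∀ᵐ ω ∂P, MvPolynomial.eval (fun i ↦ Φ (e i) ω) q = 0 := by
    filter_upwards [coeFn_polyVal hΦ e q, Lp.coeFn_zero ℝ 2 P] with ω h1 h2
    rw [← h1, hq, h2, Pi.zero_apply]
  have hms : MeasurableSet {y : EuclideanSpace ℝ (Fin m) | MvPolynomial.eval y.ofLp q = 0} :=
    (isClosed_singleton.preimage (hcont.comp (PiLp.continuous_ofLp 2 _))).measurableSet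
  have h1 : ∀ᵐ y ∂(P.map fun ω ↦ (WithLp.toLp 2 (fun i ↦ Φ (e i) ω) : EuclideanSpace ℝ (Fin m))),
      MvPolynomial.eval y.ofLp q = 0 :=
    (ae_map_iff (IsGaussianField.aemeasurable_tuple Φ e) hms).2 h0
  rw [hlaw, ae_map_iff (by fun_prop) hms] at h1
  have : (gaussianReal 0 1).IsOpenPosMeasure :=
    (gaussianReal_absolutelyContinuous' 0 one_ne_zero).isOpenPosMeasure
  have h2 := (hcont.ae_eq_iff_eq (Measure.pi fun _ : Fin m ↦ gaussianReal 0 1)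
    (continuous_const (y := (0 : ℝ)))).1 h1
  exact MvPolynomial.funext fun x ↦ by simpa using congrFun h2 x

theorem exists_orthonormal_of_mem_malliavinGraph [IsFiniteMeasure P] (hΦ : IsGaussianField P Φ)
    (x : Lp ℝ 2 P × Lp L 2 P) (hx : x ∈ malliavinGraph hΦ) :
    ∃ (m : ℕ) (e : Fin m → L) (p : MvPolynomial (Fin m) ℝ), Orthonormal ℝ e ∧
      x = (polyVal hΦ e p, polyGrad hΦ e p) := by
  refine Submodule.span_induction ?_ ?_ ?_ ?_ hx
  · rintro _ ⟨n, h, p, rfl⟩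
    have hfin : FiniteDimensional ℝ (Submodule.span ℝ (Set.range h)) :=
      FiniteDimensional.span_of_finite ℝ (Set.finite_range h)
    obtain ⟨m, e, he, hS⟩ := exists_orthonormal (Submodule.span ℝ (Set.range h))
    choose A hA using fun i ↦ hS (h i) (Submodule.subset_span ⟨i, rfl⟩)
    exact ⟨m, e, linSubst A p, he, by
      rw [polyVal_linSubst hΦ A h e hA, polyGrad_linSubst hΦ A h e hA]⟩
  · exact ⟨0, Fin.elim0, 0, ⟨fun i ↦ i.elim0, fun i ↦ i.elim0⟩, by simp [polyGrad_eq]; rfl⟩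
  · rintro _ _ _ _ ⟨n, h, p, -, rfl⟩ ⟨n', h', p', -, rfl⟩
    have hfin : FiniteDimensional ℝ (Submodule.span ℝ (Set.range h ∪ Set.range h')) :=
      FiniteDimensional.span_of_finite ℝ ((Set.finite_range h).union (Set.finite_range h'))
    obtain ⟨m, e, he, hS⟩ :=
      exists_orthonormal (Submodule.span ℝ (Set.range h ∪ Set.range h'))
    choose A hA using fun i ↦ hS (h i) (Submodule.subset_span (Or.inl ⟨i, rfl⟩))
    choose A' hA' using fun i ↦ hS (h' i) (Submodule.subset_span (Or.inr ⟨i, rfl⟩))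
    exact ⟨m, e, linSubst A p + linSubst A' p', he, by
      rw [map_add, polyGrad_add, polyVal_linSubst hΦ A h e hA, polyGrad_linSubst hΦ A h e hA,
        polyVal_linSubst hΦ A' h' e hA', polyGrad_linSubst hΦ A' h' e hA', Prod.mk_add_mk]⟩
  · rintro c _ _ ⟨m, e, p, he, rfl⟩
    exact ⟨m, e, c • p, he, by rw [map_smul, polyGrad_smul, Prod.smul_mk]⟩

theorem malliavinGraph_functional [IsFiniteMeasure P] (hΦ : IsGaussianField P Φ)
    (x : Lp ℝ 2 P × Lp L 2 P) (hx : x ∈ malliavinGraph hΦ) (hx0 : x.1 = 0) : x.2 = 0 := by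
  obtain ⟨m, e, p, he, rfl⟩ := exists_orthonormal_of_mem_malliavinGraph hΦ x hx
  have hp := eq_zero_of_polyVal_eq_zero hΦ e he p hx0
  simp [hp, polyGrad_eq]

theorem malliavinDerivative_graph [IsFiniteMeasure P] (hΦ : IsGaussianField P Φ) :
    (malliavinDerivative hΦ).graph = malliavinGraph hΦ :=
  Submodule.toLinearPMap_graph_eq _ (malliavinGraph_functional hΦ)

theorem malliavinDerivative_domain [IsFiniteMeasure P] (hΦ : IsGaussianField P Φ) :
    (malliavinDerivative hΦ).domain = Submodule.span ℝ {F | ∃ (n : ℕ) (h : Fin n → L)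
      (p : MvPolynomial (Fin n) ℝ), F = polyVal hΦ h p} := by
  rw [malliavinDerivative, Submodule.toLinearPMap_domain, malliavinGraph, Submodule.map_span]
  congr 1
  ext F
  constructor
  · rintro ⟨_, ⟨n, h, p, rfl⟩, rfl⟩
    exact ⟨n, h, p, rfl⟩
  · rintro ⟨n, h, p, rfl⟩
    exact ⟨_, ⟨n, h, p, rfl⟩, rfl⟩

theorem malliavinDerivative_apply [IsFiniteMeasure P] (hΦ : IsGaussianField P Φ) {n : ℕ}
    (h : Fin n → L) (p : MvPolynomial (Fin n) ℝ)
    (hF : polyVal hΦ h p ∈ (malliavinDerivative hΦ).domain) :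
    malliavinDerivative hΦ ⟨polyVal hΦ h p, hF⟩ =
      ∑ j, elemTensor (polyVal hΦ h (MvPolynomial.pderiv j p)) (h j) := by
  have h1 : (polyVal hΦ h p, polyGrad hΦ h p) ∈ (malliavinDerivative hΦ).graph := by
    rw [malliavinDerivative_graph]
    exact Submodule.subset_span ⟨n, h, p, rfl⟩
  exact ((LinearPMap.mem_graph_iff' _).1 h1).elim fun y hy ↦ by
    have hy' : y = ⟨polyVal hΦ h p, hF⟩ := Subtype.ext (congrArg Prod.fst hy)
    rw [← hy']
    exact congrArg Prod.snd hy

end GaussianField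

/-! ### The Ornstein-Uhlenbeck operator on polynomials. -/

namespace MvPolynomial

variable {σ : Type*}

/-! Everything reduces to polynomials in finitely many orthonormal coordinates, whose law is
standard Gaussian. There E[xᵢ p] = E[∂ᵢp] gives ∑ᵢ E[∂ᵢp ∂ᵢq] = E[p Nq] with N = ∑ᵢ (xᵢ∂ᵢ - ∂ᵢ²). So
T*T acts as N on polynomials, and the range of T lies in the domain of T*
(`exists_adjoint_of_mem_malliavinGraph`). If (0, G) is in the closure of the graph, then G is
orthogonal to the range of T and also a limit of vectors of that range, so G = 0: T is closable.

For the kernel, the Poincaré inequality ‖F‖² - (E F)² ≤ ‖TF‖² passes to the closure, and TF = 0 then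
forces F = E F. Its proof (`poincare_of_stein`) is algebraic and avoids Hermite expansions: every
polynomial is a constant plus some Nu (`exists_eq_C_add_ornsteinUhlenbeck`), and the commutation ∂ⱼN
= (N + 1)∂ⱼ (`pderiv_ornsteinUhlenbeck`) supplies the spectral gap. -/

theorem pderiv_pderiv_comm (i j : σ) (p : MvPolynomial σ ℝ) :
    pderiv i (pderiv j p) = pderiv j (pderiv i p) := by
  classical
  -- A commutator of derivations is a derivation, so it is enough to test it on the variables.
  have h : ⁅pderiv (R := ℝ) i, pderiv (R := ℝ) j⁆ = 0 := by
    refine derivation_ext fun k ↦ ?_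
    simp [Derivation.commutator_apply, pderiv_X, Pi.single_apply, apply_ite]
  have := congrArg (fun D ↦ D p) h
  simpa [Derivation.commutator_apply, sub_eq_zero] using this

variable [Fintype σ]

/-- The (nonnegative) Ornstein-Uhlenbeck operator `p ↦ ∑ᵢ (xᵢ ∂ᵢp - ∂ᵢ²p)` on polynomials. -/
noncomputable def ornsteinUhlenbeck : MvPolynomial σ ℝ →ₗ[ℝ] MvPolynomial σ ℝ :=
  ∑ i, (LinearMap.mulLeft ℝ (X i) ∘ₗ (pderiv i).toLinearMap -
    (pderiv i).toLinearMap ∘ₗ (pderiv i).toLinearMap)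

theorem ornsteinUhlenbeck_apply (p : MvPolynomial σ ℝ) :
    ornsteinUhlenbeck p = ∑ i, (X i * pderiv i p - pderiv i (pderiv i p)) := by
  simp [ornsteinUhlenbeck]

theorem pderiv_ornsteinUhlenbeck (j : σ) (p : MvPolynomial σ ℝ) :
    pderiv j (ornsteinUhlenbeck p) = ornsteinUhlenbeck (pderiv j p) + pderiv j p := by
  classical
  have h : ∀ i, pderiv j (X i * pderiv i p - pderiv i (pderiv i p)) =
      (X i * pderiv i (pderiv j p) - pderiv i (pderiv i (pderiv j p))) +
        if i = j then pderiv j p else 0 := fun i ↦ by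
    rw [map_sub, pderiv_mul, pderiv_X, pderiv_pderiv_comm j i (pderiv i p),
      pderiv_pderiv_comm j i p]
    split_ifs with hij
    · subst hij
      simp
      ring
    · simp [Ne.symm hij]
  simp only [ornsteinUhlenbeck_apply, map_sum, h, Finset.sum_add_distrib]
  simp

/-- Euler's identity: N multiplies a monomial by its degree, up to terms of lower degree. -/
theorem ornsteinUhlenbeck_monomial (s : σ →₀ ℕ) (a : ℝ) :
    ornsteinUhlenbeck (monomial s a) =
      s.degree • monomial s a - ∑ i, pderiv i (pderiv i (monomial s a)) := by
  rw [ornsteinUhlenbeck_apply, Finset.sum_sub_distrib]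
  congr 1
  simp only [X_mul_pderiv_monomial]
  rw [← Finset.sum_smul, Finsupp.degree_eq_sum]

/-- N is triangular for the degree, with diagonal entry n in degree n. Strong induction inverts it
in positive degrees, and only the constants are missed. -/
theorem exists_eq_C_add_ornsteinUhlenbeck (p : MvPolynomial σ ℝ) :
    ∃ (c : ℝ) (u : MvPolynomial σ ℝ), p = C c + ornsteinUhlenbeck u := by
  let S : Submodule ℝ (MvPolynomial σ ℝ) :=
    LinearMap.range (Algebra.linearMap ℝ (MvPolynomial σ ℝ)) ⊔ LinearMap.range ornsteinUhlenbeck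
  have hmon : ∀ (n : ℕ) (s : σ →₀ ℕ) (a : ℝ), s.degree = n → monomial s a ∈ S := by
    intro n
    induction n using Nat.strong_induction_on with
    | _ n ih =>
      intro s a hs
      rcases Nat.eq_zero_or_pos n with rfl | hn
      · rw [Finsupp.degree_eq_zero_iff] at hs
        subst hs
        exact Submodule.mem_sup_left ⟨a, rfl⟩
      · have h1 : s.degree • monomial s a ∈ S := by
          rw [← sub_add_cancel (s.degree • monomial s a)
            (∑ i, pderiv i (pderiv i (monomial s a))), ← ornsteinUhlenbeck_monomial]
          refine S.add_mem (Submodule.mem_sup_right ⟨_, rfl⟩) (S.sum_mem fun i _ ↦ ?_)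
          rw [pderiv_monomial, pderiv_monomial]
          rcases Nat.eq_zero_or_pos (s i) with h0 | h0
          · simp [h0]
          -- Also covers `s i = 1`: truncated subtraction lowers the degree, which is all the
          -- induction needs.
          · refine ih _ ?_ _ _ rfl
            rw [← hs, Finsupp.degree_eq_sum, Finsupp.degree_eq_sum]
            refine Finset.sum_lt_sum (fun j _ ↦ ?_) ⟨i, Finset.mem_univ _, ?_⟩
            · simp only [Finsupp.tsub_apply]
              omega
            · simp only [Finsupp.tsub_apply, Finsupp.single_eq_same]
              omega
        have h2 := S.smul_mem ((n : ℝ)⁻¹) h1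
        rwa [hs, ← Nat.cast_smul_eq_nsmul ℝ, smul_smul, inv_mul_cancel₀ (by positivity),
          one_smul] at h2
  have hp : p ∈ S := by
    rw [p.as_sum]
    exact S.sum_mem fun s _ ↦ hmon _ s _ rfl
  obtain ⟨_, ⟨c, rfl⟩, _, ⟨u, rfl⟩, h⟩ := Submodule.mem_sup.1 hp
  exact ⟨c, u, h.symm⟩

/-! ### Integration by parts and the Poincaré inequality for functionals on polynomials. -/

section Stein

variable {E : MvPolynomial σ ℝ →ₗ[ℝ] ℝ}

/-- The Dirichlet form of the Ornstein-Uhlenbeck operator, for a linear functional that satisfies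
the Gaussian integration by parts formula. -/
theorem sum_pderiv_mul_pderiv_of_stein (hE : ∀ i p, E (X i * p) = E (pderiv i p))
    (p q : MvPolynomial σ ℝ) :
    ∑ i, E (pderiv i p * pderiv i q) = E (p * ornsteinUhlenbeck q) := by
  rw [ornsteinUhlenbeck_apply, Finset.mul_sum, map_sum]
  refine Finset.sum_congr rfl fun i _ ↦ ?_
  have h := hE i (p * pderiv i q)
  rw [pderiv_mul, map_add] at h
  rw [mul_sub, map_sub, mul_left_comm]
  linarith

/-- The Gaussian Poincaré inequality for polynomials. -/
theorem poincare_of_stein (hE : ∀ i p, E (X i * p) = E (pderiv i p))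
    (hpos : ∀ p, 0 ≤ E (p * p)) (h1 : E 1 = 1) (p : MvPolynomial σ ℝ) :
    E (p * p) - E p ^ 2 ≤ ∑ i, E (pderiv i p * pderiv i p) := by
  obtain ⟨c, u, rfl⟩ := exists_eq_C_add_ornsteinUhlenbeck p
  have hmean : E (ornsteinUhlenbeck u) = 0 := by
    have := sum_pderiv_mul_pderiv_of_stein hE 1 u
    simpa using this.symm
  have hC : ∀ q, E (C c * q) = c * E q := fun q ↦ by
    rw [← smul_eq_C_mul, map_smul, smul_eq_mul]
  have hEp : E (C c + ornsteinUhlenbeck u) = c := by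
    have := hC 1
    rw [mul_one, h1, mul_one] at this
    rw [map_add, hmean, this, add_zero]
  have hvar : E ((C c + ornsteinUhlenbeck u) * (C c + ornsteinUhlenbeck u)) =
      c ^ 2 + E (ornsteinUhlenbeck u * ornsteinUhlenbeck u) := by
    have : (C c + ornsteinUhlenbeck u) * (C c + ornsteinUhlenbeck u) =
        C c * (C c * 1) + C c * ornsteinUhlenbeck u + C c * ornsteinUhlenbeck u +
          ornsteinUhlenbeck u * ornsteinUhlenbeck u := by ring
    rw [this, map_add, map_add, map_add, hC, hC, hC, hmean, h1]
    ring
  rw [hvar, hEp]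
  simp only [map_add, pderiv_C, zero_add]
  -- With `v` the image of `u`: `E v² = ∑ᵢ E[∂ᵢv ∂ᵢu]`, and `∑ᵢ E[(∂ᵢu)²] ≤ ∑ᵢ E[∂ᵢv ∂ᵢu]`.
  have hvu := sum_pderiv_mul_pderiv_of_stein hE (ornsteinUhlenbeck u) u
  have hle : ∑ i, E (pderiv i u * pderiv i u) ≤
      ∑ i, E (pderiv i (ornsteinUhlenbeck u) * pderiv i u) := by
    refine Finset.sum_le_sum fun i _ ↦ ?_
    rw [pderiv_ornsteinUhlenbeck, add_mul, map_add, mul_comm (ornsteinUhlenbeck _),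
      ← sum_pderiv_mul_pderiv_of_stein hE]
    have : 0 ≤ ∑ j, E (pderiv j (pderiv i u) * pderiv j (pderiv i u)) :=
      Finset.sum_nonneg fun j _ ↦ hpos _
    linarith
  -- Put A = ∑ E[(∂ᵢv)²], B = ∑ E[∂ᵢv ∂ᵢu], C = ∑ E[(∂ᵢu)²]. This square gives A ≥ 2B - C, and C ≤
  -- B, so A ≥ B = E v².
  have hsq : 0 ≤ ∑ i, E ((pderiv i (ornsteinUhlenbeck u) - pderiv i u) *
      (pderiv i (ornsteinUhlenbeck u) - pderiv i u)) := Finset.sum_nonneg fun i _ ↦ hpos _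
  have hexp : ∀ i, E ((pderiv i (ornsteinUhlenbeck u) - pderiv i u) *
      (pderiv i (ornsteinUhlenbeck u) - pderiv i u)) =
      E (pderiv i (ornsteinUhlenbeck u) * pderiv i (ornsteinUhlenbeck u)) -
        2 * E (pderiv i (ornsteinUhlenbeck u) * pderiv i u) + E (pderiv i u * pderiv i u) :=
    fun i ↦ by
      rw [mul_sub, sub_mul, sub_mul, map_sub, map_sub, map_sub,
        mul_comm (pderiv i u) (pderiv i (ornsteinUhlenbeck u))]
      ring
  simp only [hexp, Finset.sum_add_distrib, Finset.sum_sub_distrib, ← Finset.mul_sum] at hsq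
  linarith

end Stein

/-- A linear functional on polynomials satisfies the Gaussian integration by parts formula as soon
as it is a product of one-variable functionals whose moments satisfy the Gaussian recursion. -/
theorem stein_of_monomial {E : MvPolynomial σ ℝ →ₗ[ℝ] ℝ} {M : ℕ → ℝ}
    (hM : ∀ k, M (k + 1) = k * M (k - 1)) (hE : ∀ s, E (monomial s 1) = ∏ i, M (s i))
    (i : σ) (p : MvPolynomial σ ℝ) : E (X i * p) = E (pderiv i p) := by
  classical
  suffices h : E ∘ₗ LinearMap.mulLeft ℝ (X i) = E ∘ₗ (pderiv i).toLinearMap from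
    LinearMap.congr_fun h p
  refine (basisMonomials σ ℝ).ext fun s ↦ ?_
  have h1 : monomial (s - Finsupp.single i 1) ((1 : ℝ) * s i) =
      (s i : ℝ) • monomial (s - Finsupp.single i 1) (1 : ℝ) := by simp [smul_monomial]
  simp only [coe_basisMonomials, LinearMap.comp_apply, LinearMap.mulLeft_apply, X, monomial_mul, one_mul, mul_one,
    Derivation.coeFn_coe, pderiv_monomial, hE]
  rw [← one_mul (s i : ℝ), h1, map_smul, hE, ← Finset.mul_prod_erase _ _ (Finset.mem_univ i),
    ← Finset.mul_prod_erase _ _ (Finset.mem_univ i), smul_eq_mul, ← mul_assoc]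
  congr 1
  · simp [add_comm 1, hM]
  · refine Finset.prod_congr rfl fun j hj ↦ ?_
    have : i ≠ j := (Finset.ne_of_mem_erase hj).symm
    simp [this]

end MvPolynomial

/-! ### Moments of the standard Gaussian. -/

namespace ProbabilityTheory

/-- Integration by parts against the density φ, using φ' = -xφ. At `k = 0` the truncated exponent is
harmless: the factor `k` vanishes, and so does the mean. -/
theorem integral_pow_succ_gaussianReal (k : ℕ) :
    ∫ x, x ^ (k + 1) ∂(gaussianReal 0 1) = k * ∫ x, x ^ (k - 1) ∂(gaussianReal 0 1) := by
  have hint : ∀ n : ℕ, Integrable (fun x ↦ x ^ n * gaussianPDFReal 0 1 x) := fun n ↦ by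
    have h := integrable_rpow_mul_exp_neg_mul_sq (b := 1 / 2) (by norm_num) (s := n)
      (by linarith [n.cast_nonneg (α := ℝ)])
    refine (h.const_mul (√(2 * Real.pi * (1 : NNReal)))⁻¹).congr (ae_of_all _ fun x ↦ ?_)
    simp only [gaussianPDFReal, Real.rpow_natCast]
    rw [mul_left_comm, show -(1 / 2) * x ^ 2 = -(x - 0) ^ 2 / (2 * ((1 : NNReal) : ℝ)) by
      rw [NNReal.coe_one]; ring]
  have hderiv : ∀ x, HasDerivAt (gaussianPDFReal 0 1) (-x * gaussianPDFReal 0 1 x) x := fun x ↦ by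
    have h1 : HasDerivAt (fun x : ℝ ↦ -(x - 0) ^ 2 / (2 * ((1 : NNReal) : ℝ))) (-x) x := by
      have := (((hasDerivAt_id x).sub_const 0).pow 2).neg.div_const (2 * ((1 : NNReal) : ℝ))
      convert! this using 1
      simp [neg_div]
    convert! h1.exp.const_mul (√(2 * Real.pi * (1 : NNReal)))⁻¹ using 1
    simp only [gaussianPDFReal]
    ring
  have hparts := integral_mul_deriv_eq_deriv_mul_of_integrable (u := fun x : ℝ ↦ x ^ k)
    (v := gaussianPDFReal 0 1) (u' := fun x ↦ k * x ^ (k - 1))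
    (v' := fun x ↦ -x * gaussianPDFReal 0 1 x) (fun x _ ↦ hasDerivAt_pow k x)
    (fun x _ ↦ hderiv x)
    ((hint (k + 1)).neg.congr (ae_of_all _ fun x ↦ by
      simp only [Pi.neg_apply, Pi.mul_apply]
      ring))
    (((hint (k - 1)).const_mul k).congr (ae_of_all _ fun x ↦ by
      simp only [Pi.mul_apply]
      ring))
    (hint k)
  rw [integral_gaussianReal_eq_integral_smul one_ne_zero,
    integral_gaussianReal_eq_integral_smul one_ne_zero, ← integral_const_mul]
  simp only [smul_eq_mul]
  calc ∫ x, gaussianPDFReal 0 1 x * x ^ (k + 1)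
      = -∫ x, x ^ k * (-x * gaussianPDFReal 0 1 x) := by
        rw [← integral_neg]
        exact integral_congr_ae (ae_of_all _ fun x ↦ by ring)
    _ = ∫ x, k * (gaussianPDFReal 0 1 x * x ^ (k - 1)) := by
        rw [hparts, neg_neg]
        exact integral_congr_ae (ae_of_all _ fun x ↦ by ring)

end ProbabilityTheory

/-! ### The Dirichlet form of the Gaussian field and closability. -/

namespace GaussianField

variable {Ω : Type*} {mΩ : MeasurableSpace Ω} {L : Type*} [NormedAddCommGroup L]
  [InnerProductSpace ℝ L] {P : Measure Ω} {Φ : L → Lp ℝ 2 P}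

theorem inner_elemTensor (F G : Lp ℝ 2 P) (k l : L) :
    inner ℝ (elemTensor F k) (elemTensor G l) = inner ℝ F G * inner ℝ k l := by
  rw [L2.inner_def, L2.inner_def, ← integral_mul_const]
  refine integral_congr_ae ?_
  filter_upwards [coeFn_elemTensor F k, coeFn_elemTensor G l] with ω h1 h2
  rw [h1, h2, real_inner_smul_left, real_inner_smul_right, real_inner_eq_re_inner,
    RCLike.inner_apply]
  simp
  ring

/-- Passing to other orthonormal coordinates commutes with the Ornstein-Uhlenbeck operator. -/
theorem ornsteinUhlenbeck_linSubst {n m : ℕ} (A : Fin n → Fin m → ℝ)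
    (hA : ∀ i k, ∑ j, A i j * A k j = if i = k then 1 else 0) (q : MvPolynomial (Fin n) ℝ) :
    (linSubst A q).ornsteinUhlenbeck = linSubst A q.ornsteinUhlenbeck := by
  have hX : ∀ i, linSubst A (MvPolynomial.X i) =
      ∑ j, A i j • (MvPolynomial.X j : MvPolynomial (Fin m) ℝ) := fun i ↦ by
    simp [linSubst, MvPolynomial.smul_eq_C_mul]
  simp only [MvPolynomial.ornsteinUhlenbeck_apply, map_sum, map_sub, map_mul, hX,
    Finset.sum_sub_distrib]
  congr 1
  -- The first-order part is invariant under every linear substitution; only the Laplacian below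
  -- needs the rows of `A` to be orthonormal.
  · simp only [pderiv_linSubst, Finset.mul_sum, Finset.sum_mul]
    rw [Finset.sum_comm]
    simp only [smul_mul_assoc, mul_smul_comm]
  · have h : ∀ j, MvPolynomial.pderiv j (MvPolynomial.pderiv j (linSubst A q)) =
        ∑ i, ∑ k, (A i j * A k j) • linSubst A (MvPolynomial.pderiv k (MvPolynomial.pderiv i q)) := fun j ↦ by
      simp only [pderiv_linSubst, map_sum, Derivation.map_smul, Finset.smul_sum, smul_smul]
    simp only [h]
    rw [Finset.sum_comm]
    refine Finset.sum_congr rfl fun i _ ↦ ?_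
    rw [Finset.sum_comm]
    simp only [← Finset.sum_smul, hA]
    simp

section FiniteMeasure

variable [IsFiniteMeasure P]

/-- The expectation of `p(Φ h₁, …, Φ hₙ)`, as a linear functional of `p`. -/
noncomputable def polyMean (hΦ : IsGaussianField P Φ) {n : ℕ} (h : Fin n → L) :
    MvPolynomial (Fin n) ℝ →ₗ[ℝ] ℝ :=
  innerₗ (Lp ℝ 2 P) (polyVal hΦ h 1) ∘ₗ polyVal hΦ h

theorem polyMean_eq_inner_one (hΦ : IsGaussianField P Φ) {n : ℕ} (h : Fin n → L)
    (p : MvPolynomial (Fin n) ℝ) :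
    polyMean hΦ h p = inner ℝ (polyVal hΦ h 1) (polyVal hΦ h p) := rfl

theorem inner_polyVal_eq_integral (hΦ : IsGaussianField P Φ) {n : ℕ} (h : Fin n → L)
    (p q : MvPolynomial (Fin n) ℝ) :
    inner ℝ (polyVal hΦ h p) (polyVal hΦ h q) =
      ∫ ω, MvPolynomial.eval (fun i ↦ Φ (h i) ω) (p * q) ∂P := by
  rw [L2.inner_def]
  refine integral_congr_ae ?_
  filter_upwards [coeFn_polyVal hΦ h p, coeFn_polyVal hΦ h q] with ω h1 h2
  rw [h1, h2, map_mul, RCLike.inner_apply, mul_comm]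
  simp

theorem polyMean_eq_integral (hΦ : IsGaussianField P Φ) {n : ℕ} (h : Fin n → L)
    (p : MvPolynomial (Fin n) ℝ) :
    polyMean hΦ h p = ∫ ω, MvPolynomial.eval (fun i ↦ Φ (h i) ω) p ∂P := by
  rw [polyMean_eq_inner_one, inner_polyVal_eq_integral, one_mul]

theorem inner_polyVal (hΦ : IsGaussianField P Φ) {n : ℕ} (h : Fin n → L)
    (p q : MvPolynomial (Fin n) ℝ) :
    inner ℝ (polyVal hΦ h p) (polyVal hΦ h q) = polyMean hΦ h (p * q) := by
  rw [inner_polyVal_eq_integral, polyMean_eq_integral]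

/-- For orthonormal `e` the Gram matrix is the identity, so the coordinates are independent standard
Gaussians and Fubini factorizes the moment. -/
theorem polyMean_monomial (hΦ : IsGaussianField P Φ) {m : ℕ} {e : Fin m → L}
    (he : Orthonormal ℝ e) (s : Fin m →₀ ℕ) :
    polyMean hΦ e (MvPolynomial.monomial s 1) = ∏ i, ∫ x, x ^ s i ∂(gaussianReal 0 1) := by
  have hG : Matrix.gram ℝ e = 1 := by
    ext i j
    rw [Matrix.gram_apply, orthonormal_iff_ite.1 he, Matrix.one_apply]
  have hlaw := hΦ.map_eq m e
  rw [hG, multivariateGaussian_zero_one, ← map_pi_eq_stdGaussian] at hlaw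
  have hcont : Continuous fun y : EuclideanSpace ℝ (Fin m) ↦ ∏ i, y i ^ s i := by fun_prop
  calc polyMean hΦ e (MvPolynomial.monomial s 1)
      = ∫ ω, ∏ i, Φ (e i) ω ^ s i ∂P := by
        rw [polyMean_eq_integral]
        simp [MvPolynomial.eval_monomial, Finsupp.prod_fintype]
    _ = ∫ y, ∏ i, y i ^ s i
          ∂(P.map fun ω ↦ (WithLp.toLp 2 (fun i ↦ Φ (e i) ω) : EuclideanSpace ℝ (Fin m))) :=
        (integral_map (IsGaussianField.aemeasurable_tuple Φ e)
          hcont.aestronglyMeasurable).symm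
    _ = ∫ x : Fin m → ℝ, ∏ i, x i ^ s i ∂(Measure.pi fun _ ↦ gaussianReal 0 1) := by
        rw [hlaw, integral_map (by fun_prop) hcont.aestronglyMeasurable]
    _ = ∏ i, ∫ x, x ^ s i ∂(gaussianReal 0 1) :=
        integral_fintype_prod_eq_prod fun i x ↦ x ^ s i

/-- Gaussian integration by parts. -/
theorem polyMean_X_mul (hΦ : IsGaussianField P Φ) {m : ℕ} {e : Fin m → L}
    (he : Orthonormal ℝ e) (i : Fin m) (p : MvPolynomial (Fin m) ℝ) :
    polyMean hΦ e (MvPolynomial.X i * p) = polyMean hΦ e (p.pderiv i) :=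
  MvPolynomial.stein_of_monomial (M := fun k ↦ ∫ x, x ^ k ∂(gaussianReal 0 1))
    integral_pow_succ_gaussianReal (polyMean_monomial hΦ he) i p

theorem inner_polyGrad_eq_sum (hΦ : IsGaussianField P Φ) {m : ℕ} {e : Fin m → L}
    (he : Orthonormal ℝ e) (p q : MvPolynomial (Fin m) ℝ) :
    inner ℝ (polyGrad hΦ e p) (polyGrad hΦ e q) =
      ∑ i, polyMean hΦ e (p.pderiv i * q.pderiv i) := by
  simp [polyGrad, sum_inner, inner_sum, inner_elemTensor, inner_polyVal,
    orthonormal_iff_ite.1 he]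

theorem inner_polyGrad (hΦ : IsGaussianField P Φ) {m : ℕ} {e : Fin m → L}
    (he : Orthonormal ℝ e) (p q : MvPolynomial (Fin m) ℝ) :
    inner ℝ (polyGrad hΦ e p) (polyGrad hΦ e q) =
      inner ℝ (polyVal hΦ e p) (polyVal hΦ e q.ornsteinUhlenbeck) := by
  rw [inner_polyGrad_eq_sum hΦ he, inner_polyVal,
    MvPolynomial.sum_pderiv_mul_pderiv_of_stein (polyMean_X_mul hΦ he)]

/-- The range of the Malliavin derivative is contained in the domain of its adjoint. -/
theorem exists_adjoint_of_mem_malliavinGraph (hΦ : IsGaussianField P Φ)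
    {y : Lp ℝ 2 P × Lp L 2 P} (hy : y ∈ malliavinGraph hΦ) :
    ∃ Z : Lp ℝ 2 P, ∀ x ∈ malliavinGraph hΦ, inner ℝ x.2 y.2 = inner ℝ x.1 Z := by
  obtain ⟨n, h, q, hh, rfl⟩ := exists_orthonormal_of_mem_malliavinGraph hΦ y hy
  -- The witness may not depend on `x`, so N is applied in coordinates adapted to `y` alone;
  -- afterwards both are moved to a common orthonormal family.
  refine ⟨polyVal hΦ h q.ornsteinUhlenbeck, fun x hx ↦ ?_⟩
  obtain ⟨n', h', p, -, rfl⟩ := exists_orthonormal_of_mem_malliavinGraph hΦ x hx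
  have hfin : FiniteDimensional ℝ (Submodule.span ℝ (Set.range h ∪ Set.range h')) :=
    FiniteDimensional.span_of_finite ℝ ((Set.finite_range h).union (Set.finite_range h'))
  obtain ⟨m, e, he, hS⟩ := exists_orthonormal (Submodule.span ℝ (Set.range h ∪ Set.range h'))
  choose A hA using fun i ↦ hS (h i) (Submodule.subset_span (Or.inl ⟨i, rfl⟩))
  choose A' hA' using fun i ↦ hS (h' i) (Submodule.subset_span (Or.inr ⟨i, rfl⟩))
  have hAA : ∀ i k, ∑ j, A i j * A k j = if i = k then 1 else 0 := fun i k ↦ by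
    rw [← orthonormal_iff_ite.1 hh i k, hA i, hA k]
    simp [sum_inner, inner_sum, real_inner_smul_left, real_inner_smul_right,
      orthonormal_iff_ite.1 he, mul_comm]
  rw [← polyVal_linSubst hΦ A h e hA q.ornsteinUhlenbeck, ← polyGrad_linSubst hΦ A h e hA,
    ← polyVal_linSubst hΦ A' h' e hA', ← polyGrad_linSubst hΦ A' h' e hA',
    inner_polyGrad hΦ he, ornsteinUhlenbeck_linSubst A hAA]

/-- No density of the domain of T or of T* is used: a limit of range vectors only has to be tested
against the range of T. -/
theorem malliavinDerivative_isClosable (hΦ : IsGaussianField P Φ) :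
    (malliavinDerivative hΦ).IsClosable := by
  refine ⟨(malliavinGraph hΦ).topologicalClosure.toLinearPMap, ?_⟩
  rw [malliavinDerivative_graph, Submodule.toLinearPMap_graph_eq]
  intro x hx hx0
  have hadj : ∀ y ∈ malliavinGraph hΦ, inner ℝ x.2 y.2 = 0 := fun y hy ↦ by
    obtain ⟨Z, hZ⟩ := exists_adjoint_of_mem_malliavinGraph hΦ hy
    have hclosed : IsClosed {x : Lp ℝ 2 P × Lp L 2 P | inner ℝ x.2 y.2 = inner ℝ x.1 Z} :=
      isClosed_eq (by fun_prop) (by fun_prop)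
    have : inner ℝ x.2 y.2 = inner ℝ x.1 Z := closure_minimal hZ hclosed hx
    rw [this, hx0, inner_zero_left]
  have hclosed : IsClosed {y : Lp ℝ 2 P × Lp L 2 P | inner ℝ x.2 y.2 = (0 : ℝ)} :=
    isClosed_eq (by fun_prop) continuous_const
  -- Since `x` itself lies in the closure of the graph, `y` may tend to `x`.
  have : inner ℝ x.2 x.2 = (0 : ℝ) := closure_minimal hadj hclosed hx
  exact inner_self_eq_zero.1 this

theorem polyVal_C (hΦ : IsGaussianField P Φ) {n : ℕ} (h : Fin n → L) (c : ℝ) :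
    polyVal hΦ h (MvPolynomial.C c) = Lp.const 2 P c := by
  refine Lp.ext ?_
  filter_upwards [coeFn_polyVal hΦ h (MvPolynomial.C c), Lp.coeFn_const 2 P c] with ω h1 h2
  rw [h1, h2, MvPolynomial.eval_C, Function.const_apply]

end FiniteMeasure

/-! ### The Poincaré inequality for the field and the kernel of the closure. -/

variable [IsProbabilityMeasure P]

/-- The Gaussian Poincaré inequality. -/
theorem norm_sub_mean_sq_le (hΦ : IsGaussianField P Φ) {x : Lp ℝ 2 P × Lp L 2 P}
    (hx : x ∈ malliavinGraph hΦ) :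
    ‖x.1‖ ^ 2 - inner ℝ (Lp.const 2 P (1 : ℝ)) x.1 ^ 2 ≤ ‖x.2‖ ^ 2 := by
  obtain ⟨m, e, p, he, rfl⟩ := exists_orthonormal_of_mem_malliavinGraph hΦ x hx
  have h1 : polyVal hΦ e 1 = Lp.const 2 P (1 : ℝ) := by
    rw [← polyVal_C hΦ e, MvPolynomial.C_1]
  have h := MvPolynomial.poincare_of_stein (polyMean_X_mul hΦ he)
    (fun p ↦ by rw [← inner_polyVal]; exact real_inner_self_nonneg)
    (by simp [polyMean_eq_integral]) p
  rwa [← inner_polyGrad_eq_sum hΦ he, ← inner_polyVal, polyMean_eq_inner_one, h1,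
    real_inner_self_eq_norm_sq, real_inner_self_eq_norm_sq] at h

theorem norm_const_one : ‖Lp.const 2 P (1 : ℝ)‖ = 1 := by
  simp [Lp.norm_const]

theorem pmapKer_closure_malliavinDerivative (hΦ : IsGaussianField P Φ) :
    pmapKer (malliavinDerivative hΦ).closure = Submodule.span ℝ {Lp.const 2 P (1 : ℝ)} := by
  have hgraph := (malliavinDerivative_isClosable hΦ).graph_closure_eq_closure_graph
  rw [malliavinDerivative_graph] at hgraph
  have hmem : ∀ F, F ∈ pmapKer (malliavinDerivative hΦ).closure ↔
      (F, (0 : Lp L 2 P)) ∈ (malliavinGraph hΦ).topologicalClosure := fun F ↦ by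
    rw [hgraph, LinearPMap.mem_graph_iff]
    simp only [pmapKer, Submodule.mem_map, LinearMap.mem_ker]
    exact ⟨fun ⟨y, h1, h2⟩ ↦ ⟨y, h2, h1⟩, fun ⟨y, h1, h2⟩ ↦ ⟨y, h2, h1⟩⟩
  ext F
  rw [hmem, Submodule.mem_span_singleton]
  constructor
  · intro hF
    have hclosed (G : Lp ℝ 2 P) :
        IsClosed {x : Lp ℝ 2 P × Lp L 2 P | ‖x.1‖ ^ 2 - inner ℝ G x.1 ^ 2 ≤ ‖x.2‖ ^ 2} :=
      isClosed_le (by fun_prop) (by fun_prop)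
    have hsub : ((malliavinGraph hΦ).topologicalClosure : Set (Lp ℝ 2 P × Lp L 2 P)) ⊆
        {x | ‖x.1‖ ^ 2 - inner ℝ (Lp.const 2 P (1 : ℝ)) x.1 ^ 2 ≤ ‖x.2‖ ^ 2} :=
      closure_minimal (fun x hx ↦ norm_sub_mean_sq_le hΦ hx) (hclosed (Lp.const 2 P (1 : ℝ)))
    have hle := hsub hF
    rw [Set.mem_ofPred_eq] at hle
    -- The coefficient is the mean m of `F`; as the constant 1 is a unit vector, ‖F - m‖² = ‖F‖² -
    -- m², which is at most 0 by `hle`.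
    refine ⟨inner ℝ (Lp.const 2 P (1 : ℝ)) F, (sub_eq_zero.1 (norm_eq_zero.1 ?_)).symm⟩
    refine pow_eq_zero_iff two_ne_zero |>.1 (le_antisymm ?_ (sq_nonneg _))
    rw [norm_sub_sq_real, norm_smul, norm_const_one, real_inner_smul_right,
      real_inner_comm (Lp.const 2 P (1 : ℝ)) F, mul_one, Real.norm_eq_abs, sq_abs]
    simp only [norm_zero] at hle
    linarith
  · rintro ⟨c, rfl⟩
    refine Submodule.le_topologicalClosure _ ?_
    have h : ((Lp.const 2 P (1 : ℝ), 0) : Lp ℝ 2 P × Lp L 2 P) ∈ malliavinGraph hΦ :=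
      -- A constant is a polynomial in no field variables, so its gradient is an empty sum.
      Submodule.subset_span ⟨0, Fin.elim0, MvPolynomial.C 1, by
        rw [polyVal_C, polyGrad]
        simp⟩
    simpa using (malliavinGraph hΦ).smul_mem c h

end GaussianField

theorem corollary3p18 {Ω : Type*} [MeasurableSpace Ω] (P : Measure Ω) [IsProbabilityMeasure P]
    {L : Type*} [NormedAddCommGroup L] [InnerProductSpace ℝ L] [CompleteSpace L]
    (Φ : L → Lp ℝ 2 P) (hΦ : GaussianField.IsGaussianField P Φ) :
    (GaussianField.malliavinDerivative hΦ).IsClosable ∧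
      GaussianField.pmapKer (GaussianField.malliavinDerivative hΦ).closure =
        Submodule.span ℝ {Lp.const 2 P (1 : ℝ)} ∧
      Module.finrank ℝ (GaussianField.pmapKer (GaussianField.malliavinDerivative hΦ).closure) =
        1 := by
  refine ⟨GaussianField.malliavinDerivative_isClosable hΦ,
    GaussianField.pmapKer_closure_malliavinDerivative hΦ, ?_⟩
  rw [GaussianField.pmapKer_closure_malliavinDerivative]
  exact finrank_span_singleton (norm_ne_zero_iff.1 (by
    rw [GaussianField.norm_const_one]
    exact one_ne_zero))
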